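/- Let $0<q<1$ be such that $\frac{\log(1-q)}{\log q}\in\mathbb{Z}$, and let $\mathbb{R}_{q,+}=\{q^n : n\in\mathbb{Z}\}$. For a function $g$ on $\mathbb{R}_{q,+}$ put $$\int_0^\infty g(t)\,d_qt=(1-q)\sum_{n=-\infty}^{\infty}g(q^n)\,q^n ,$$ provided the sum converges absolutely (for $g\ge 0$ the value $+\infty$ is allowed). Let $L_q^2(\mathbb{R}_{q,+})$ be the set of functions $f:\mathbb{R}_{q,+}\to\mathbb{C}$ with $\|f\|_{q,2}=\left(\int_0^\infty|f(t)|^2d_qt\right)^{1/2}<\infty$, and let $$D_qf(x)=\frac{f(x)-f(qx)}{(1-q)x}\qquad(x\in\mathbb{R}_{q,+}).$$ Further, with $(a;q)_n=\prod_{k=0}^{n-1}(1-aq^k)$, $(a;q)_\infty=\prod_{k=0}^{\infty}(1-aq^k)$ and $[n]_q!=\frac{(q;q)_n}{(1-q)^n}$, let $$\cos(x;q^2)=\sum_{n=0}^\infty(-1)^nq^{n(n-1)}\frac{x^{2n}}{[2n]_q!},\qquad \Gamma_q(x)=\frac{(q;q)_\infty}{(q^x;q)_\infty}(1-q)^{1-x},\qquad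 c_q=\frac{(1+q^{-1})^{1/2}}{\Gamma_{q^2}(1/2)},$$ and define the $q$-Fourier-cosine transform by $$\mathcal{F}_q(f)(x)=c_q\int_0^\infty f(t)\cos(xt;q^2)\,d_qt .$$ **Theorem.** Let $f\in L_q^2(\mathbb{R}_{q,+})$ be such that $D_qf\in L_q^2(\mathbb{R}_{q,+})$. Then the integral defining $\mathcal{F}_q(f)(x)$ converges absolutely for every $x\in\mathbb{R}_{q,+}$, and $$\left(\int_0^\infty t^2|f(t)|^2d_qt\right)^{1/2}\left(\int_0^\infty x^2|\mathcal{F}_q(f)(x)|^2d_qx\right)^{1/2}\ \ge\ \frac{q}{q^{3/2}+1}\,\|f\|_{q,2}^2$$ as an inequality in $[0,\infty]$, with the convention $\infty\cdot 0=0$. -/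

import Mathlib

noncomputable section

namespace QCalc

/-- The lattice `ℝ_{q,+} = {q ^ n : n ∈ ℤ}`. -/
def lattice (q : ℝ) : Set ℝ := Set.range fun n : ℤ => q ^ n

/-- The finite `q`-shifted factorial `(a; q)_n = ∏_{k < n} (1 - a q ^ k)`. -/
def shiftedFactorial (a q : ℝ) (n : ℕ) : ℝ := ∏ k ∈ Finset.range n, (1 - a * q ^ k)

/-- The infinite `q`-shifted factorial `(a; q)_∞ = ∏_{k ≥ 0} (1 - a q ^ k)`. -/
def shiftedFactorialInf (a q : ℝ) : ℝ := ∏' k : ℕ, (1 - a * q ^ k)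

/-- The `q`-factorial `[n]_q! = (q; q)_n / (1 - q) ^ n`. -/
def factorial (q : ℝ) (n : ℕ) : ℝ := shiftedFactorial q q n / (1 - q) ^ n

/-- Jackson's `q`-Gamma function
`Γ_q(x) = (q; q)_∞ / (q ^ x; q)_∞ * (1 - q) ^ (1 - x)` at a real `x ≠ 0, -1, -2, …`. -/
def gamma (q x : ℝ) : ℝ :=
  shiftedFactorialInf q q / shiftedFactorialInf (q ^ x) q * (1 - q) ^ (1 - x)

/-- The `q`-cosine
`cos(x; q²) = ∑_{n ≥ 0} (-1) ^ n q ^ (n (n - 1)) x ^ (2 n) / [2 n]_q!`. -/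
def cos (q x : ℝ) : ℝ :=
  ∑' n : ℕ, (-1) ^ n * q ^ (n * (n - 1)) * (x ^ (2 * n) / factorial q (2 * n))

/-- The `q`-derivative `D_q f (x) = (f x - f (q x)) / ((1 - q) x)` for `x ≠ 0`,
and `D_q f (0) = f' (0)`. At a point of the lattice it depends only on `f` on the lattice. -/
def qDeriv (q : ℝ) (f : ℝ → ℂ) (x : ℝ) : ℂ :=
  if x = 0 then deriv f 0 else (f x - f (q * x)) / (((1 - q) * x : ℝ) : ℂ)

/-- Absolute convergence of the series defining `∫₀^∞ f(t) d_q t`. -/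
def JacksonIntegrable (q : ℝ) (f : ℝ → ℂ) : Prop :=
  Summable fun n : ℤ => ‖f (q ^ n) * ((q ^ n : ℝ) : ℂ)‖

/-- The `q`-Jackson integral `∫₀^∞ f(t) d_q t = (1 - q) ∑_{n ∈ ℤ} f(q ^ n) q ^ n` of a
complex-valued function. -/
def jacksonIntegral (q : ℝ) (f : ℝ → ℂ) : ℂ :=
  ((1 - q : ℝ) : ℂ) * ∑' n : ℤ, f (q ^ n) * ((q ^ n : ℝ) : ℂ)

/-- The same integral for a nonnegative function, with value in `[0, ∞]`. -/
def jacksonLIntegral (q : ℝ) (g : ℝ → ENNReal) : ENNReal :=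
  ENNReal.ofReal (1 - q) * ∑' n : ℤ, g (q ^ n) * ENNReal.ofReal (q ^ n)

/-- The norm `‖f‖_{q,p} = (∫₀^∞ |f(t)| ^ p d_q t) ^ (1 / p)`, with value in `[0, ∞]`. -/
def lpNorm (q : ℝ) (p : ℕ) (f : ℝ → ℂ) : ENNReal :=
  (jacksonLIntegral q fun t => ‖f t‖ₑ ^ p) ^ (1 / (p : ℝ))

/-- `f ∈ L_q^p(ℝ_{q,+})`, that is `∫₀^∞ |f(t)| ^ p d_q t < ∞`. A function on the lattice is
represented by a function on `ℝ` of which only the values on the lattice matter. -/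
def MemLq (q : ℝ) (p : ℕ) (f : ℝ → ℂ) : Prop :=
  (jacksonLIntegral q fun t => ‖f t‖ₑ ^ p) < ⊤

/-- The constant `c_q = (1 + q⁻¹) ^ (1 / 2) / Γ_{q²}(1 / 2)`. -/
def fourierConst (q : ℝ) : ℝ :=
  (1 + q⁻¹) ^ (1 / 2 : ℝ) / gamma (q ^ 2) (1 / 2)

/-- The `q`-Fourier-cosine transform `ℱ_q f (x) = c_q ∫₀^∞ f(t) cos(x t; q²) d_q t`. -/
def fourierCos (q : ℝ) (f : ℝ → ℂ) (x : ℝ) : ℂ :=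
  (fourierConst q : ℂ) * jacksonIntegral q fun t => f t * (cos q (x * t) : ℂ)

end QCalc

end

/-! Heisenberg's argument carries over to the lattice. Two facts suffice: ‖x ℱ_q f‖ = √q ‖D_q f‖
(`jacksonLIntegral_mul_fourierCos`) and ‖f‖² ≤ (q + q^(-1/2)) ‖t f‖ ‖D_q f‖
(`jacksonLIntegral_le_mul_qDeriv`). The constants combine to √q / (q + q^(-1/2)) = q / (q^(3/2) +
1).

The inequality comes from summing the differences of |f|² along the lattice and applying
Cauchy–Schwarz.

For the equality, the q-cosine is the q-derivative of the q-sine, so summation by parts turns x ℱ_q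
f(x) into a q-sine transform of D_q f. The hypothesis on q says 1 - q = q^m, so the rescaled
argument (1 - q)x stays on the lattice. In the exponents n, k the transform then has a Hankel matrix
K(n + k), and it is isometric once the shifts of K are orthonormal (`hankel_isometry`). K is a
weighted ₁φ₁. Its shifts solve the same three-term recurrence with different eigenvalues, hence are
orthogonal (`qBessel_orthogonal`). Its norm follows because the sum of all correlations of a
sequence is the square of its sum, which a generating function evaluates (`tsum_qBessel_sq`). -/

open Filter Topology

noncomputable section

namespace QCalc

/-! ### Euler's power series for (x; p)_∞ and its inverse. -/

/-- Terms whose ratio is dominated by a geometric sequence decay faster than any power. -/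
theorem summable_norm_of_ratio_le {a : ℕ → ℝ} {p C : ℝ} (hp0 : 0 < p) (hp1 : p < 1)
    (ha : ∀ k, |a (k + 1)| ≤ C * p ^ k * |a k|) (x : ℝ) : Summable fun k => ‖a k * x ^ k‖ := by
  have hlim : Tendsto (fun k : ℕ => C * |x| * p ^ k) atTop (𝓝 (C * |x| * 0)) :=
    (tendsto_pow_atTop_nhds_zero_of_lt_one hp0.le hp1).const_mul _
  rw [mul_zero] at hlim
  refine summable_of_ratio_norm_eventually_le (r := 1 / 2) (by norm_num) ?_
  filter_upwards [hlim.eventually_le_const (show (0 : ℝ) < 1 / 2 by norm_num)] with k hk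
  rw [norm_norm, norm_norm, norm_mul, norm_mul, norm_pow, norm_pow]
  simp only [Real.norm_eq_abs]
  calc |a (k + 1)| * |x| ^ (k + 1) ≤ C * p ^ k * |a k| * |x| ^ (k + 1) := by
        gcongr; exact ha k
    _ = (C * |x| * p ^ k) * (|a k| * |x| ^ k) := by ring
    _ ≤ 1 / 2 * (|a k| * |x| ^ k) := by gcongr

/-- An absolutely convergent power series tends to its constant term along `p ^ N * x`. -/
theorem tendsto_tsum_geometric_dilation {a : ℕ → ℝ} {p x : ℝ} (hp0 : 0 < p) (hp1 : p < 1)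
    (ha : Summable fun k => ‖a k * x ^ k‖) :
    Tendsto (fun N : ℕ => ∑' k, a k * (p ^ N * x) ^ k) atTop (𝓝 (a 0)) := by
  have hlim : ∑' k : ℕ, (if k = 0 then a 0 else 0) = a 0 := by simp
  rw [← hlim]
  refine tendsto_tsum_of_dominated_convergence ha ?_ ?_
  · intro k
    by_cases hk : k = 0
    · subst hk; simp
    · have h : Tendsto (fun N : ℕ => a k * x ^ k * (p ^ k) ^ N) atTop (𝓝 (a k * x ^ k * 0)) :=
        (tendsto_pow_atTop_nhds_zero_of_lt_one (by positivity)
          (pow_lt_one₀ hp0.le hp1 hk)).const_mul _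
      simp only [hk, if_false]
      rw [mul_zero] at h
      refine h.congr fun N => ?_
      rw [mul_pow, ← pow_mul, ← pow_mul, mul_comm k N]; ring
  · refine Eventually.of_forall fun N k => ?_
    rw [mul_pow, norm_mul, norm_mul, norm_mul, mul_left_comm]
    have : ‖(p ^ N) ^ k‖ ≤ 1 := by
      rw [Real.norm_of_nonneg (by positivity)]
      exact pow_le_one₀ (by positivity) (pow_le_one₀ hp0.le hp1.le)
    exact mul_le_of_le_one_left (by positivity) this

theorem one_sub_pow_pos {p : ℝ} (hp0 : 0 < p) (hp1 : p < 1) (k : ℕ) : 0 < 1 - p ^ (k + 1) :=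
  sub_pos.2 (pow_lt_one₀ hp0.le hp1 (Nat.succ_ne_zero k))

theorem shiftedFactorial_succ (a q : ℝ) (n : ℕ) :
    shiftedFactorial a q (n + 1) = shiftedFactorial a q n * (1 - a * q ^ n) :=
  Finset.prod_range_succ _ _

theorem shiftedFactorial_self_pos {p : ℝ} (hp0 : 0 < p) (hp1 : p < 1) (n : ℕ) :
    0 < shiftedFactorial p p n :=
  Finset.prod_pos fun k _ => by
    rw [← pow_succ']; exact one_sub_pow_pos hp0 hp1 k

/-- The coefficients of `(x; p)_∞` as a power series in `x`. -/
def eulerCoeff (p : ℝ) (k : ℕ) : ℝ := (-1) ^ k * p ^ (k.choose 2) / shiftedFactorial p p k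

/-- Euler's power series for `(x; p)_∞`. -/
def euler (p x : ℝ) : ℝ := ∑' k, eulerCoeff p k * x ^ k

/-- Euler's power series for `1 / (x; p)_∞`. -/
def eulerInv (p x : ℝ) : ℝ := ∑' k, (shiftedFactorial p p k)⁻¹ * x ^ k

section
variable {p : ℝ} (hp0 : 0 < p) (hp1 : p < 1)
include hp0 hp1

theorem eulerCoeff_succ (k : ℕ) :
    eulerCoeff p (k + 1) * (1 - p ^ (k + 1)) = -(p ^ k * eulerCoeff p k) := by
  have h1 := (shiftedFactorial_self_pos hp0 hp1 k).ne'
  have h2 := (one_sub_pow_pos hp0 hp1 k).ne'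
  rw [eulerCoeff, eulerCoeff, shiftedFactorial_succ, ← pow_succ', Nat.choose_succ_succ' k 1,
    Nat.choose_one_right]
  field_simp
  ring

theorem abs_eulerCoeff_succ_le (k : ℕ) :
    |eulerCoeff p (k + 1)| ≤ (1 - p)⁻¹ * p ^ k * |eulerCoeff p k| := by
  have h := congrArg abs (eulerCoeff_succ hp0 hp1 k)
  rw [abs_mul, abs_neg, abs_mul, abs_of_pos (one_sub_pow_pos hp0 hp1 k),
    abs_of_pos (pow_pos hp0 k)] at h
  rw [mul_assoc, ← h, inv_mul_eq_div, le_div_iff₀ (sub_pos.2 hp1)]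
  gcongr
  exact pow_le_of_le_one hp0.le hp1.le (Nat.succ_ne_zero k)

theorem summable_norm_eulerCoeff (x : ℝ) : Summable fun k => ‖eulerCoeff p k * x ^ k‖ :=
  summable_norm_of_ratio_le hp0 hp1 (abs_eulerCoeff_succ_le hp0 hp1) x

theorem euler_eq_mul (x : ℝ) : euler p x = (1 - x) * euler p (p * x) := by
  have h1 := (summable_norm_eulerCoeff hp0 hp1 x).of_norm
  have h2 := (summable_norm_eulerCoeff hp0 hp1 (p * x)).of_norm
  have h : euler p x - euler p (p * x) = -x * euler p (p * x) := by
    rw [euler, euler, ← h1.tsum_sub h2, (h1.sub h2).tsum_eq_zero_add, ← tsum_mul_left]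
    simp only [pow_zero, sub_self, zero_add]
    refine tsum_congr fun k => ?_
    have := eulerCoeff_succ hp0 hp1 k
    rw [mul_pow, mul_pow]
    linear_combination x ^ (k + 1) * this
  linear_combination h

theorem euler_eq_shiftedFactorial_mul (x : ℝ) (N : ℕ) :
    euler p x = shiftedFactorial x p N * euler p (p ^ N * x) := by
  induction N with
  | zero => simp [shiftedFactorial]
  | succ N ih =>
    rw [ih, euler_eq_mul hp0 hp1 (p ^ N * x), shiftedFactorial_succ, ← mul_assoc p, ← pow_succ']
    ring

theorem tendsto_euler (x : ℝ) : Tendsto (fun N : ℕ => euler p (p ^ N * x)) atTop (𝓝 1) := by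
  have := tendsto_tsum_geometric_dilation hp0 hp1 (summable_norm_eulerCoeff hp0 hp1 x)
  rwa [show eulerCoeff p 0 = 1 by simp [eulerCoeff, shiftedFactorial]] at this

/-- Iterating the functional equation `euler_eq_mul` splits off the partial products, and the
remaining factor tends to 1. -/
theorem shiftedFactorialInf_eq_euler (x : ℝ) : shiftedFactorialInf x p = euler p x := by
  have hs : Summable fun k : ℕ => ‖-(x * p ^ k)‖ := by
    simp only [norm_neg]
    exact ((summable_geometric_of_lt_one hp0.le hp1).mul_left x).norm
  have hm : Multipliable fun k : ℕ => 1 - x * p ^ k := by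
    simpa [sub_eq_add_neg] using multipliable_one_add_of_summable hs
  have h1 := hm.hasProd.tendsto_prod_nat
  have h2 : Tendsto (fun N : ℕ => shiftedFactorial x p N * euler p (p ^ N * x)) atTop
      (𝓝 (shiftedFactorialInf x p * 1)) := h1.mul (tendsto_euler hp0 hp1 x)
  rw [mul_one] at h2
  refine tendsto_nhds_unique h2 ?_
  simp only [← euler_eq_shiftedFactorial_mul hp0 hp1]
  exact tendsto_const_nhds

theorem summable_eulerInv {x : ℝ} (hx0 : 0 < x) (hx1 : x < 1) :
    Summable fun k => (shiftedFactorial p p k)⁻¹ * x ^ k := by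
  have hpos := shiftedFactorial_self_pos hp0 hp1
  refine summable_of_ratio_test_tendsto_lt_one hx1
    (Eventually.of_forall fun k => mul_ne_zero (inv_ne_zero (hpos k).ne') (by positivity)) ?_
  have h : Tendsto (fun k : ℕ => x / (1 - p * p ^ k)) atTop (𝓝 (x / (1 - p * 0))) :=
    tendsto_const_nhds.div
      (((tendsto_pow_atTop_nhds_zero_of_lt_one hp0.le hp1).const_mul p).const_sub 1) (by simp)
  rw [mul_zero, sub_zero, div_one] at h
  refine h.congr fun k => ?_
  have h1 := (hpos k).ne'
  have h2 : 1 - p * p ^ k ≠ 0 := by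
    rw [← pow_succ']; exact (one_sub_pow_pos hp0 hp1 k).ne'
  rw [Real.norm_of_nonneg (mul_nonneg (inv_nonneg.2 (hpos _).le) (by positivity)),
    Real.norm_of_nonneg (mul_nonneg (inv_nonneg.2 (hpos _).le) (by positivity)),
    shiftedFactorial_succ, pow_succ]
  field_simp

theorem eulerInv_mul {x : ℝ} (hx0 : 0 < x) (hx1 : x < 1) :
    eulerInv p x * (1 - x) = eulerInv p (p * x) := by
  have h1 := summable_eulerInv hp0 hp1 hx0 hx1
  have h2 := summable_eulerInv hp0 hp1 (mul_pos hp0 hx0)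
    (mul_lt_one_of_nonneg_of_lt_one_left hp0.le hp1 hx1.le)
  have h : eulerInv p x - eulerInv p (p * x) = x * eulerInv p x := by
    rw [eulerInv, eulerInv, ← h1.tsum_sub h2, (h1.sub h2).tsum_eq_zero_add, ← tsum_mul_left]
    simp only [pow_zero, sub_self, zero_add]
    refine tsum_congr fun k => ?_
    have h3 := (shiftedFactorial_self_pos hp0 hp1 k).ne'
    have h4 := (one_sub_pow_pos hp0 hp1 k).ne'
    rw [shiftedFactorial_succ, ← pow_succ', mul_pow]
    field_simp
    ring
  linear_combination h

/-- The two functional equations make the product invariant under x ↦ p x, and it tends to 1 along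
p^N x. Besides nonvanishing of (x; p)_∞, this gives the cancellation in `tsum_qBessel_sq`. -/
theorem eulerInv_mul_euler {x : ℝ} (hx0 : 0 < x) (hx1 : x < 1) :
    eulerInv p x * euler p x = 1 := by
  have hN : ∀ N : ℕ, eulerInv p (p ^ N * x) * euler p (p ^ N * x) = eulerInv p x * euler p x := by
    intro N
    induction N with
    | zero => simp
    | succ N ih =>
      have h1 : p ^ N * x < 1 :=
        mul_lt_one_of_nonneg_of_lt_one_right (pow_le_one₀ hp0.le hp1.le) hx0.le hx1
      rw [← ih, euler_eq_mul hp0 hp1 (p ^ N * x), pow_succ', mul_assoc,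
        ← eulerInv_mul hp0 hp1 (by positivity) h1]
      ring
  have hG : Tendsto (fun N : ℕ => eulerInv p (p ^ N * x)) atTop (𝓝 1) := by
    have := tendsto_tsum_geometric_dilation hp0 hp1 (summable_eulerInv hp0 hp1 hx0 hx1).norm
    rwa [show (shiftedFactorial p p 0)⁻¹ = 1 by simp [shiftedFactorial]] at this
  have h := hG.mul (tendsto_euler hp0 hp1 x)
  simp only [hN, mul_one] at h
  exact tendsto_nhds_unique tendsto_const_nhds h

theorem euler_ne_zero {x : ℝ} (hx0 : 0 < x) (hx1 : x < 1) : euler p x ≠ 0 := fun h => by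
  simpa [h] using eulerInv_mul_euler hp0 hp1 hx0 hx1

theorem norm_euler_le {x y : ℝ} (hxy : |x| ≤ y) :
    ‖euler p x‖ ≤ ∑' k, ‖eulerCoeff p k * y ^ k‖ := by
  refine tsum_of_norm_bounded (summable_norm_eulerCoeff hp0 hp1 y).hasSum fun k => ?_
  rw [norm_mul, norm_mul, norm_pow, norm_pow]
  have : ‖x‖ ≤ ‖y‖ := hxy.trans (le_abs_self y)
  gcongr

/-- One factor of the product is 1 - p^j p^(-j). These zeros make the bilateral sums below
effectively one-sided. -/
theorem euler_zpow_eq_zero {j : ℤ} (hj : j ≤ 0) : euler p (p ^ j) = 0 := by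
  obtain ⟨n, rfl⟩ := Int.exists_eq_neg_ofNat hj
  rw [euler_eq_shiftedFactorial_mul hp0 hp1 _ (n + 1), shiftedFactorial_succ, zpow_neg,
    zpow_natCast, inv_mul_cancel₀ (by positivity)]
  simp

theorem euler_zpow_succ (n : ℕ) :
    euler p (p ^ ((n : ℤ) + 1)) = euler p p * (shiftedFactorial p p n)⁻¹ := by
  rw [euler_eq_shiftedFactorial_mul hp0 hp1 p n, ← pow_succ, mul_right_comm,
    mul_inv_cancel₀ (shiftedFactorial_self_pos hp0 hp1 n).ne', one_mul]
  norm_cast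

/-- Summation of `(p ^ j; p)_∞ t ^ j` over all integers `j`. -/
theorem hasSum_euler_zpow {t : ℝ} (ht0 : 0 < t) (ht1 : t < 1) :
    HasSum (fun j : ℤ => t ^ j * euler p (p ^ j)) (t * euler p p * eulerInv p t) := by
  have hinj : Function.Injective fun n : ℕ => (n : ℤ) + 1 := fun a b h => by simpa using h
  rw [← hinj.hasSum_iff]
  · refine ((summable_eulerInv hp0 hp1 ht0 ht1).hasSum.mul_left (t * euler p p)).congr_fun fun n => ?_
    simp only [Function.comp_apply, euler_zpow_succ hp0 hp1]
    rw [zpow_add_one₀ ht0.ne', zpow_natCast]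
    ring
  · intro j hj
    rw [euler_zpow_eq_zero hp0 hp1, mul_zero]
    by_contra! h
    exact hj ⟨(j - 1).toNat, by simp; omega⟩

end

/-! ### The ₁φ₁ function: symmetry, recurrence, generating function. -/

/-- The entire function `(w; p)_∞ * ₁φ₁(0; w; p, z)`, a `q`-analogue of the Bessel functions. -/
def qBessel (p w z : ℝ) : ℝ := ∑' k, eulerCoeff p k * euler p (w * p ^ k) * z ^ k

section
variable {p : ℝ} (hp0 : 0 < p) (hp1 : p < 1)
include hp0 hp1

theorem summable_norm_qBessel (w z : ℝ) :
    Summable fun k => ‖eulerCoeff p k * euler p (w * p ^ k) * z ^ k‖ := by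
  refine ((summable_norm_eulerCoeff hp0 hp1 z).mul_right
    (∑' k, ‖eulerCoeff p k * |w| ^ k‖)).of_nonneg_of_le (fun _ => norm_nonneg _) fun k => ?_
  have h : |w * p ^ k| ≤ |w| := by
    rw [abs_mul, abs_of_pos (pow_pos hp0 k)]
    exact mul_le_of_le_one_right (abs_nonneg w) (pow_le_one₀ hp0.le hp1.le)
  rw [mul_right_comm, norm_mul]
  gcongr
  exact norm_euler_le hp0 hp1 h

/-- Expanding the inner Euler series gives a double series whose only coupling factor p^(k l) is
symmetric in k and l. -/
theorem qBessel_comm (w z : ℝ) : qBessel p w z = qBessel p z w := by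
  let F : ℝ → ℝ → ℕ → ℕ → ℝ := fun w z k l =>
    eulerCoeff p k * z ^ k * (eulerCoeff p l * w ^ l) * p ^ (k * l)
  have key : ∀ w z : ℝ, qBessel p w z = ∑' k, ∑' l, F w z k l := fun w z => by
    refine tsum_congr fun k => ?_
    rw [euler, mul_right_comm, ← tsum_mul_left]
    refine tsum_congr fun l => ?_
    rw [mul_pow, ← pow_mul p k l]; ring
  have hs : Summable (Function.uncurry (F w z)) := by
    refine Summable.of_norm_bounded ((summable_norm_eulerCoeff hp0 hp1 z).mul_norm
      (summable_norm_eulerCoeff hp0 hp1 w)) fun x => ?_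
    rw [Function.uncurry, norm_mul, Real.norm_of_nonneg (pow_nonneg hp0.le _)]
    exact mul_le_of_le_one_right (norm_nonneg _) (pow_le_one₀ hp0.le hp1.le)
  rw [key w z, key z w, ← hs.tsum_comm]
  refine tsum_congr fun l => tsum_congr fun k => ?_
  simp only [F]
  rw [mul_comm k l, mul_comm (eulerCoeff p k * z ^ k)]

/-- Comparison of coefficients in z. On z = p^n this is a three-term recurrence whose only
n-dependent coefficient is the multiplication by p^n. -/
theorem qBessel_recurrence (w z : ℝ) :
    p * z * qBessel p w (p * z) =
      (p + w) * qBessel p w (p * z) - p * qBessel p w z - w * qBessel p w (p ^ 2 * z) := by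
  have h0 := (summable_norm_qBessel hp0 hp1 w z).of_norm
  have h1 := (summable_norm_qBessel hp0 hp1 w (p * z)).of_norm
  have h2 := (summable_norm_qBessel hp0 hp1 w (p ^ 2 * z)).of_norm
  have hs := ((h1.mul_left (p + w)).sub (h0.mul_left p)).sub (h2.mul_left w)
  rw [qBessel, qBessel, qBessel, ← tsum_mul_left, ← tsum_mul_left, ← tsum_mul_left,
    ← tsum_mul_left, ← (h1.mul_left (p + w)).tsum_sub (h0.mul_left p),
    ← ((h1.mul_left (p + w)).sub (h0.mul_left p)).tsum_sub (h2.mul_left w), hs.tsum_eq_zero_add]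
  simp only [pow_zero]
  rw [show ∀ c : ℝ, (p + w) * (c * 1) - p * (c * 1) - w * (c * 1) = 0 by intro c; ring, zero_add]
  refine tsum_congr fun k => ?_
  have ha := eulerCoeff_succ hp0 hp1 k
  have he := euler_eq_mul hp0 hp1 (w * p ^ k)
  rw [show p * (w * p ^ k) = w * p ^ (k + 1) by ring] at he
  rw [he]
  have : (p ^ 2 * z) ^ (k + 1) = p ^ (k + 1) * p ^ (k + 1) * z ^ (k + 1) := by ring
  rw [this, mul_pow, mul_pow]
  linear_combination
    (p - w * p ^ (k + 1)) * euler p (w * p ^ (k + 1)) * z ^ (k + 1) * ha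

/-- The generating function of the values of `qBessel p w` on the lattice `p ^ n`. -/
theorem hasSum_qBessel_zpow {t : ℝ} (ht0 : 0 < t) (ht1 : t < 1) (w : ℝ) :
    Summable (fun n : ℤ => ‖t ^ n * qBessel p w (p ^ n)‖) ∧
    ∑' n : ℤ, t ^ n * qBessel p w (p ^ n) =
      euler p (w / t) * (t * euler p p * eulerInv p t) := by
  have hE := hasSum_euler_zpow hp0 hp1 ht0 ht1
  have hA := summable_norm_eulerCoeff hp0 hp1 (w / t)
  have hprod := hA.mul_norm hE.summable.norm
  -- Substituting j = n + k gives t^n w^k = t^j (w/t)^k, so the double sum factors.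
  let e : ℕ × ℤ ≃ ℕ × ℤ := Equiv.prodShear (Equiv.refl ℕ) fun k => Equiv.addRight (k : ℤ)
  have hterm : ∀ x : ℕ × ℤ, eulerCoeff p (e x).1 * (w / t) ^ (e x).1 *
      (t ^ (e x).2 * euler p (p ^ (e x).2)) =
      t ^ x.2 * (eulerCoeff p x.1 * euler p (p ^ x.2 * p ^ x.1) * w ^ x.1) := by
    rintro ⟨k, n⟩
    simp only [e, Equiv.prodShear_apply, Equiv.refl_apply, Equiv.coe_addRight]
    rw [zpow_add₀ ht0.ne', zpow_add₀ hp0.ne', zpow_natCast, zpow_natCast, div_pow]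
    field_simp
  have hs := (e.summable_iff.2 hprod)
  have hs' : Summable fun x : ℕ × ℤ =>
      ‖t ^ x.2 * (eulerCoeff p x.1 * euler p (p ^ x.2 * p ^ x.1) * w ^ x.1)‖ :=
    hs.congr fun x => by rw [← hterm]; rfl
  have hJ : ∀ n : ℤ, t ^ n * qBessel p w (p ^ n) =
      ∑' k, t ^ n * (eulerCoeff p k * euler p (p ^ n * p ^ k) * w ^ k) := fun n => by
    rw [qBessel_comm hp0 hp1, qBessel, tsum_mul_left]
  have hsw := hs'.prod_symm
  constructor
  · refine hsw.prod.of_nonneg_of_le (fun _ => norm_nonneg _) fun n => ?_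
    rw [hJ]
    exact norm_tsum_le_tsum_norm (hsw.prod_factor n)
  · simp only [hJ]
    rw [← hE.tsum_eq, euler, tsum_mul_tsum_of_summable_norm hA hE.summable.norm,
      ← e.tsum_eq, tsum_congr hterm, hs'.of_norm.tsum_prod, hs'.of_norm.tsum_comm]

end

/-! ### Orthogonality and norm of the shifted kernels. -/

theorem summable_shift {f : ℤ → ℝ} (hf : Summable f) (l : ℤ) : Summable fun n => f (n + l) :=
  hf.comp_injective (add_left_injective l)

theorem tsum_sub_shift_eq_zero {C : ℤ → ℝ} (hC : Summable C) : ∑' n, (C n - C (n - 1)) = 0 := by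
  have hC' : Summable fun n => C (n - 1) := summable_shift hC (-1)
  rw [hC.tsum_sub hC', sub_eq_zero]
  exact ((Equiv.subRight (1 : ℤ)).tsum_eq C).symm

theorem summable_mul_of_norm {F G : ℤ → ℝ} (hF : Summable fun n => ‖F n‖)
    (hG : Summable fun n => ‖G n‖) : Summable fun n => F n * G n := by
  have h : Summable fun x : ℤ × ℤ => F x.1 * G x.2 := summable_mul_of_summable_norm hF hG
  have hinj : Function.Injective fun n : ℤ => (n, n) := fun a b h => by simpa using h
  exact h.comp_injective hinj

/-- Summable eigenvectors of a tridiagonal symmetric operator are orthogonal. -/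
theorem tsum_mul_eq_zero_of_three_term {A B v : ℤ → ℝ} {α β μ : ℝ} (hμ : μ ≠ 1)
    (hA : Summable fun n => ‖A n‖) (hB : Summable fun n => ‖B n‖)
    (hAv : ∀ n, v n * A n = α * A n + β * (A (n - 1) + A (n + 1)))
    (hBv : ∀ n, μ * v n * B n = α * B n + β * (B (n - 1) + B (n + 1))) :
    ∑' n, v n * A n * B n = 0 := by
  have hA1 : Summable fun n => ‖A (n + 1)‖ := summable_shift hA 1
  have hB1 : Summable fun n => ‖B (n + 1)‖ := summable_shift hB 1
  -- The Casoratian of A and B: its differences are (μ - 1) v A B, which therefore telescope to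
  -- zero.
  have hC : Summable fun n => β * (A n * B (n + 1) - A (n + 1) * B n) :=
    ((summable_mul_of_norm hA hB1).sub (summable_mul_of_norm hA1 hB)).mul_left β
  have h0 := tsum_sub_shift_eq_zero hC
  have h1 : ∑' n, (μ - 1) * (v n * A n * B n) = 0 := by
    rw [← h0]
    refine tsum_congr fun n => ?_
    rw [sub_add_cancel n 1]
    linear_combination A n * hBv n - B n * hAv n
  rw [tsum_mul_left] at h1
  exact (mul_eq_zero.1 h1).resolve_left (sub_ne_zero.2 hμ)

section
variable {s ρ : ℝ} (hs0 : 0 < s) (hs1 : s < 1) (hρ0 : 0 < ρ) (hρ1 : ρ < 1)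
include hs0 hs1 hρ0 hρ1

/-- The factor ρ^n symmetrizes the recurrence, both neighbours getting the coefficient -s²ρ. A shift
by l multiplies the eigenvalue by s^(2l) ≠ 1. The orthogonality has weight s^(2n), split evenly
between the factors. -/
theorem qBessel_orthogonal {l : ℤ} (hl : l ≠ 0) :
    ∑' n : ℤ, (ρ * s) ^ n * qBessel (s ^ 2) ((ρ * s) ^ 2) ((s ^ 2) ^ n) *
      ((ρ * s) ^ n * qBessel (s ^ 2) ((ρ * s) ^ 2) ((s ^ 2) ^ (n + l))) = 0 := by
  have hp0 : 0 < s ^ 2 := by positivity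
  have hp1 : s ^ 2 < 1 := pow_lt_one₀ hs0.le hs1 two_ne_zero
  set J : ℤ → ℝ := fun n => qBessel (s ^ 2) ((ρ * s) ^ 2) ((s ^ 2) ^ n) with hJ
  have hrec : ∀ n, (s ^ 2) ^ n * J n = (s ^ 2 + (ρ * s) ^ 2) * J n - s ^ 2 * J (n - 1) -
      (ρ * s) ^ 2 * J (n + 1) := fun n => by
    have h := qBessel_recurrence hp0 hp1 ((ρ * s) ^ 2) ((s ^ 2) ^ (n - 1))
    have e1 : s ^ 2 * (s ^ 2) ^ (n - 1) = (s ^ 2) ^ n := by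
      rw [zpow_sub_one₀ hp0.ne', mul_comm, inv_mul_cancel_right₀ hp0.ne']
    have e2 : (s ^ 2) ^ 2 * (s ^ 2) ^ (n - 1) = (s ^ 2) ^ (n + 1) := by
      rw [sq (s ^ 2), mul_assoc, e1, zpow_add_one₀ hp0.ne', mul_comm]
    rwa [e1, e2] at h
  have hsum := (hasSum_qBessel_zpow hp0 hp1 hρ0 hρ1 ((ρ * s) ^ 2)).1
  have hsuml : Summable fun n : ℤ => ‖ρ ^ n * J (n + l)‖ := by
    refine ((summable_shift hsum l).mul_left (‖ρ ^ (-l)‖)).congr fun n => ?_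
    rw [← norm_mul, ← mul_assoc, ← zpow_add₀ hρ0.ne']
    rw [neg_add_cancel_comm_assoc]
  have step : ∀ n : ℤ, ρ ^ (n - 1) = ρ ^ n * ρ⁻¹ ∧ ρ ^ (n + 1) = ρ ^ n * ρ := fun n =>
    ⟨zpow_sub_one₀ hρ0.ne' n, zpow_add_one₀ hρ0.ne' n⟩
  have hμ : (s ^ 2) ^ l ≠ 1 := by
    rw [Ne, zpow_eq_one_iff_right₀ hp0.le hp1.ne]; exact hl
  have h := tsum_mul_eq_zero_of_three_term (A := fun n => ρ ^ n * J n)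
    (B := fun n => ρ ^ n * J (n + l)) (v := fun n => (s ^ 2) ^ n)
    (α := s ^ 2 * (1 + ρ ^ 2)) (β := -(s ^ 2 * ρ)) hμ hsum hsuml
    (fun n => by
      simp only [(step n).1, (step n).2]
      field_simp
      linear_combination hrec n)
    (fun n => by
      have h := hrec (n + l)
      rw [zpow_add₀ hp0.ne', add_sub_right_comm, add_right_comm] at h
      simp only [(step n).1, (step n).2]
      field_simp
      linear_combination h)
  rw [← h]
  refine tsum_congr fun n => ?_
  rw [mul_zpow, show (s ^ 2) ^ n * (ρ ^ n * J n) * (ρ ^ n * J (n + l)) =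
    s ^ n * s ^ n * (ρ ^ n * J n) * (ρ ^ n * J (n + l)) by rw [sq, mul_zpow]]
  simp only [hJ]
  ring

/-- Summing F(n) F(l + n) over n and l gives (∑ F)². By orthogonality only l = 0 contributes, so the
squared norm is the square of the sum. -/
theorem tsum_qBessel_sq :
    ∑' n : ℤ, (ρ * s) ^ n * qBessel (s ^ 2) ((ρ * s) ^ 2) ((s ^ 2) ^ n) *
      ((ρ * s) ^ n * qBessel (s ^ 2) ((ρ * s) ^ 2) ((s ^ 2) ^ n)) =
      (ρ * s * euler (s ^ 2) (s ^ 2)) ^ 2 := by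
  have hp0 : 0 < s ^ 2 := by positivity
  have hp1 : s ^ 2 < 1 := pow_lt_one₀ hs0.le hs1 two_ne_zero
  have ht0 : 0 < ρ * s := by positivity
  have ht1 : ρ * s < 1 := mul_lt_one_of_nonneg_of_lt_one_left hρ0.le hρ1 hs1.le
  obtain ⟨hsum, hval⟩ := hasSum_qBessel_zpow hp0 hp1 ht0 ht1 ((ρ * s) ^ 2)
  -- With w = t² at t = ρ s the factor `euler` at w/t = t cancels `eulerInv` at t.
  have hval' : ∑' n : ℤ, (ρ * s) ^ n * qBessel (s ^ 2) ((ρ * s) ^ 2) ((s ^ 2) ^ n) =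
      ρ * s * euler (s ^ 2) (s ^ 2) := by
    rw [hval, sq (ρ * s), mul_div_cancel_right₀ _ ht0.ne']
    linear_combination ρ * s * euler (s ^ 2) (s ^ 2) * eulerInv_mul_euler hp0 hp1 ht0 ht1
  let F : ℤ → ℝ := fun n => (ρ * s) ^ n * qBessel (s ^ 2) ((ρ * s) ^ 2) ((s ^ 2) ^ n)
  let e : ℤ × ℤ ≃ ℤ × ℤ := Equiv.prodShear (Equiv.refl ℤ) fun k => Equiv.addRight k
  have hprod := e.summable_iff.2 (hsum.mul_norm hsum)
  have hs : Summable fun x : ℤ × ℤ => F x.1 * F (x.2 + x.1) := Summable.of_norm hprod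
  have hzero : ∀ l : ℤ, l ≠ 0 → ∑' n, F n * F (l + n) = 0 := fun l hl => by
    have h := congrArg ((ρ * s) ^ l * ·) (qBessel_orthogonal hs0 hs1 hρ0 hρ1 hl)
    simp only [mul_zero] at h
    rw [← h, ← tsum_mul_left]
    refine tsum_congr fun n => ?_
    simp only [F]
    rw [add_comm l n, zpow_add₀ ht0.ne']; ring
  have h0 : ∑' n, F n * F (0 + n) = ∑' l, ∑' n, F n * F (l + n) :=
    (tsum_eq_single 0 hzero).symm
  simp only [zero_add] at h0
  calc ∑' n, F n * F n = ∑' l, ∑' n, F n * F (l + n) := h0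
    _ = ∑' n, ∑' l, F n * F (l + n) := hs.tsum_comm
    _ = ∑' x : ℤ × ℤ, F x.1 * F (x.2 + x.1) := hs.tsum_prod.symm
    _ = ∑' x : ℤ × ℤ, F x.1 * F x.2 := e.tsum_eq fun x : ℤ × ℤ => F x.1 * F x.2
    _ = (∑' n, F n) * ∑' n, F n := (tsum_mul_tsum_of_summable_norm hsum hsum).symm
    _ = _ := by rw [hval', ← sq]

end

/-- An orthonormality relation for the shifts of `K` makes the Hankel transform isometric. -/
theorem hankel_isometry {K : ℤ → ℝ} (hK : Summable fun n => ‖K n‖)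
    (hK0 : ∑' n, K n * K n = 1) (hKl : ∀ l, l ≠ 0 → ∑' n, K n * K (n + l) = 0)
    {v : ℤ → ℂ} (hv : Summable fun n => ‖v n‖ ^ 2) :
    Summable (fun k => ‖∑' n, v n * (K (n + k) : ℂ)‖ ^ 2) ∧
    ∑' k, ‖∑' n, v n * (K (n + k) : ℂ)‖ ^ 2 = ∑' n, ‖v n‖ ^ 2 := by
  have mem_two : ∀ {u : ℤ → ℂ}, (Summable fun n => ‖u n‖ ^ 2) → Memℓp u 2 := fun {u} hu =>
    memℓp_gen (by simpa using hu)
  have hsq : Summable fun n => K n * K n :=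
    summable_mul_of_norm hK hK
  have hmem : ∀ n : ℤ, Memℓp (fun k : ℤ => (K (n + k) : ℂ)) 2 := fun n => mem_two <| by
    refine ((Equiv.addLeft n).summable_iff.2 hsq).congr fun k => ?_
    simp [sq]
  let E : ℤ → lp (fun _ : ℤ => ℂ) 2 := fun n => ⟨_, hmem n⟩
  have hinner : ∀ a b : ℤ, inner ℂ (E a) (E b) = ((∑' n, K n * K (n + (b - a)) : ℝ) : ℂ) := by
    intro a b
    rw [lp.inner_eq_tsum, Complex.ofReal_tsum, ← (Equiv.addLeft (-a)).tsum_eq]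
    refine tsum_congr fun k => ?_
    simp only [E, Equiv.coe_addLeft, RCLike.inner_apply, Complex.conj_ofReal, Complex.ofReal_mul]
    rw [add_neg_cancel_left, mul_comm, show b + (-a + k) = k + (b - a) by ring]
  have horth : Orthonormal ℂ E := by
    rw [orthonormal_iff_ite]
    intro a b
    rw [hinner]
    split_ifs with h
    · subst h; simp [hK0]
    · rw [hKl _ (sub_ne_zero.2 (Ne.symm h))]; simp
  let V : lp (fun _ : ℤ => ℂ) 2 := ⟨v, mem_two hv⟩
  -- Synthesis along an orthonormal family is isometric, and its k-th coordinate is the Hankel sum;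
  -- completeness of the family plays no role.
  let T := horth.orthogonalFamily.linearIsometry
  have hT : HasSum (fun n => v n • E n) (T V) := horth.orthogonalFamily.hasSum_linearIsometry V
  have hTk : ∀ k, ∑' n, v n * (K (n + k) : ℂ) = T V k := fun k =>
    ((lp.evalCLM ℂ (fun _ : ℤ => ℂ) 2 k).hasSum hT).tsum_eq
  have hnorm : ‖T V‖ = ‖V‖ := T.norm_map V
  have n1 := lp.hasSum_norm (p := 2) (by norm_num) (T V)
  have n2 := lp.hasSum_norm (p := 2) (by norm_num) V
  rw [hnorm] at n1
  simp only [ENNReal.toReal_ofNat, Real.rpow_ofNat] at n1 n2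
  simp only [hTk]
  exact ⟨n1.summable, n1.tsum_eq.trans n2.tsum_eq.symm⟩

/-! ### The q-sine kernel and its normalization. -/

/-- The `q`-sine in the form `sin(x; q²) = (1 - q) * x * qSinSeries q (((1 - q) * x) ^ 2)`. -/
def qSinSeries (q y : ℝ) : ℝ := qBessel (q ^ 2) (q ^ 3) y / euler (q ^ 2) q

theorem shiftedFactorial_two_mul (q : ℝ) (k : ℕ) :
    shiftedFactorial q q (2 * k) =
      shiftedFactorial q (q ^ 2) k * shiftedFactorial (q ^ 2) (q ^ 2) k := by
  induction k with
  | zero => simp [shiftedFactorial]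
  | succ k ih =>
    rw [show 2 * (k + 1) = 2 * k + 1 + 1 by ring, shiftedFactorial_succ, shiftedFactorial_succ, ih,
      shiftedFactorial_succ, shiftedFactorial_succ]
    ring

theorem sqrt_zpow_mul_self {q : ℝ} (hq0 : 0 < q) (n : ℤ) : √q ^ n * √q ^ n = q ^ n := by
  rw [← mul_zpow, Real.mul_self_sqrt hq0.le]

theorem sqrt_lt_one_of_lt_one {q : ℝ} (hq1 : q < 1) : √q < 1 := by
  rwa [Real.sqrt_lt' one_pos, one_pow]

section
variable {q : ℝ} (hq0 : 0 < q) (hq1 : q < 1)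
include hq0 hq1

/-- This is D_q sin = cos, written for the series without the prefactor (1 - q) x. -/
theorem cos_eq_qSinSeries (x : ℝ) :
    cos q x = qSinSeries q (((1 - q) * x) ^ 2) - q * qSinSeries q (q ^ 2 * ((1 - q) * x) ^ 2) := by
  have hp0 : 0 < q ^ 2 := by positivity
  have hp1 : q ^ 2 < 1 := pow_lt_one₀ hq0.le hq1 two_ne_zero
  set y := ((1 - q) * x) ^ 2 with hy
  have hE := euler_ne_zero hp0 hp1 hq0 hq1
  have h1 := (summable_norm_qBessel hp0 hp1 (q ^ 3) y).of_norm.div_const (euler (q ^ 2) q)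
  have h2 := ((summable_norm_qBessel hp0 hp1 (q ^ 3) (q ^ 2 * y)).of_norm.div_const
    (euler (q ^ 2) q)).mul_left q
  rw [qSinSeries, qSinSeries, qBessel, qBessel, ← tsum_div_const, ← tsum_div_const,
    ← tsum_mul_left, ← h1.tsum_sub h2]
  refine tsum_congr fun k => ?_
  have he := euler_eq_shiftedFactorial_mul hp0 hp1 q k
  rw [euler_eq_mul hp0 hp1 ((q ^ 2) ^ k * q),
    show q ^ 2 * ((q ^ 2) ^ k * q) = q ^ 3 * (q ^ 2) ^ k by ring] at he
  have hchoose : (q ^ 2) ^ k.choose 2 = q ^ (k * (k - 1)) := by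
    rw [← pow_mul, Nat.choose_two_right, Nat.two_mul_div_two_of_even (Nat.even_mul_pred_self k)]
  have hy' : y ^ k = (1 - q) ^ (2 * k) * x ^ (2 * k) := by
    rw [hy, ← pow_mul, mul_pow]
  have h3 := (shiftedFactorial_self_pos hp0 hp1 k).ne'
  have h4 : shiftedFactorial q (q ^ 2) k ≠ 0 := fun h => hE (by rw [he, h]; ring)
  have h5 : (1 - q) ^ (2 * k) ≠ 0 := pow_ne_zero _ (sub_ne_zero.2 hq1.ne')
  rw [factorial, shiftedFactorial_two_mul, eulerCoeff, hchoose, mul_pow, hy']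
  have h6 : euler (q ^ 2) (q ^ 3 * (q ^ 2) ^ k) * (1 - q * (q ^ 2) ^ k) / euler (q ^ 2) q =
      (shiftedFactorial q (q ^ 2) k)⁻¹ := by
    rw [div_eq_iff hE, he]
    field_simp
  calc _ = (-1) ^ k * q ^ (k * (k - 1)) / shiftedFactorial (q ^ 2) (q ^ 2) k *
        ((1 - q) ^ (2 * k) * x ^ (2 * k)) * (shiftedFactorial q (q ^ 2) k)⁻¹ := by
        field_simp
    _ = _ := by
        rw [← h6]
        ring

/-- The Gamma value at 1/2 becomes a quotient of Euler products; this is the identity that gives the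
sine kernel norm 1. -/
theorem fourierConst_sq :
    fourierConst q ^ 2 * (q * (1 - q) * euler (q ^ 2) (q ^ 2) ^ 2) = euler (q ^ 2) q ^ 2 := by
  have hp0 : 0 < q ^ 2 := by positivity
  have hp1 : q ^ 2 < 1 := pow_lt_one₀ hq0.le hq1 two_ne_zero
  have hE1 := euler_ne_zero hp0 hp1 hp0 hp1
  have hE2 := euler_ne_zero hp0 hp1 hq0 hq1
  have hsqrt : (q ^ 2) ^ (1 / 2 : ℝ) = q := by rw [← Real.sqrt_eq_rpow, Real.sqrt_sq hq0.le]
  have hsq : ∀ {a : ℝ}, 0 ≤ a → (a ^ (1 / 2 : ℝ)) ^ 2 = a := fun ha => by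
    rw [← Real.sqrt_eq_rpow, Real.sq_sqrt ha]
  have h1 : 0 < 1 - q := sub_pos.2 hq1
  rw [fourierConst, gamma, hsqrt, shiftedFactorialInf_eq_euler hp0 hp1,
    shiftedFactorialInf_eq_euler hp0 hp1, show (1 : ℝ) - 1 / 2 = 1 / 2 by norm_num, div_pow,
    mul_pow, div_pow, hsq (by positivity), hsq (sub_nonneg.2 hp1.le),
    show 1 - q ^ 2 = (1 - q) * (1 + q) by ring]
  field_simp
  ring

end

/-- The normalized kernel of the `q`-sine transform in logarithmic coordinates. -/
def sinKernel (q : ℝ) (m j : ℤ) : ℝ :=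
  fourierConst q * (1 - q) ^ 2 * q⁻¹ * (√q * q) ^ (j + 1) * qSinSeries q ((q ^ 2) ^ (j + 1 + m))

/-- Identifies the kernel with the orthogonal family at s = q, ρ = √q, where w = (ρ s)² = q³. -/
theorem sinKernel_eq {q : ℝ} (hq0 : 0 < q) (m j : ℤ) :
    sinKernel q m j = fourierConst q * (1 - q) ^ 2 * q⁻¹ * (√q * q) ^ (-m) / euler (q ^ 2) q *
      ((√q * q) ^ (j + (1 + m)) *
        qBessel (q ^ 2) ((√q * q) ^ 2) ((q ^ 2) ^ (j + (1 + m)))) := by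
  have ht : √q * q ≠ 0 := by positivity
  rw [sinKernel, qSinSeries, mul_pow, Real.sq_sqrt hq0.le, ← pow_succ', ← add_assoc,
    show (√q * q) ^ (j + 1) = (√q * q) ^ (-m) * (√q * q) ^ (j + 1 + m) by
      rw [← zpow_add₀ ht]; congr 1; ring]
  ring

section
variable {q : ℝ} (hq0 : 0 < q) (hq1 : q < 1) {m : ℤ} (hm : 1 - q = q ^ m)
include hq0 hq1

theorem summable_qBessel_weighted {t : ℝ} (ht0 : 0 < t) (ht1 : t < 1) (w : ℝ) (l : ℤ) :
    Summable fun n : ℤ => ‖t ^ n * qBessel (q ^ 2) w ((q ^ 2) ^ (n + l))‖ := by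
  have hp1 : q ^ 2 < 1 := pow_lt_one₀ hq0.le hq1 two_ne_zero
  have h := (hasSum_qBessel_zpow (by positivity) hp1 ht0 ht1 w).1
  refine ((summable_shift h l).mul_left ‖t ^ (-l)‖).congr fun n => ?_
  rw [← norm_mul, ← mul_assoc, ← zpow_add₀ ht0.ne', neg_add_cancel_comm_assoc]

theorem summable_sinKernel (m : ℤ) : Summable fun j => ‖sinKernel q m j‖ := by
  have ht1 : √q * q < 1 :=
    mul_lt_one_of_nonneg_of_lt_one_left (Real.sqrt_nonneg q) (sqrt_lt_one_of_lt_one hq1) hq1.le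
  have hp1 : q ^ 2 < 1 := pow_lt_one₀ hq0.le hq1 two_ne_zero
  have h := (hasSum_qBessel_zpow (by positivity) hp1 (by positivity) ht1 ((√q * q) ^ 2)).1
  refine ((summable_shift h (1 + m)).mul_left ‖fourierConst q * (1 - q) ^ 2 * q⁻¹ *
    (√q * q) ^ (-m) / euler (q ^ 2) q‖).congr fun j => ?_
  rw [sinKernel_eq hq0, norm_mul _ (_ * _)]

theorem sinKernel_orthogonal (m : ℤ) {l : ℤ} (hl : l ≠ 0) :
    ∑' n, sinKernel q m n * sinKernel q m (n + l) = 0 := by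
  have h := qBessel_orthogonal hq0 hq1 (Real.sqrt_pos.2 hq0) (sqrt_lt_one_of_lt_one hq1) hl
  have ht : √q * q ≠ 0 := by positivity
  rw [← (Equiv.addRight (1 + m)).tsum_eq] at h
  set γ := fourierConst q * (1 - q) ^ 2 * q⁻¹ * (√q * q) ^ (-m) / euler (q ^ 2) q
  rw [← mul_zero (γ ^ 2 * (√q * q) ^ l), ← h, ← tsum_mul_left]
  refine tsum_congr fun n => ?_
  rw [sinKernel_eq hq0, sinKernel_eq hq0, Equiv.coe_addRight,
    show n + l + (1 + m) = n + (1 + m) + l by ring, zpow_add₀ ht _ l]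
  ring

include hm in
theorem tsum_sinKernel_sq : ∑' n, sinKernel q m n * sinKernel q m n = 1 := by
  have hp0 : 0 < q ^ 2 := by positivity
  have hp1 : q ^ 2 < 1 := pow_lt_one₀ hq0.le hq1 two_ne_zero
  have h := tsum_qBessel_sq hq0 hq1 (Real.sqrt_pos.2 hq0) (sqrt_lt_one_of_lt_one hq1)
  have hE := euler_ne_zero hp0 hp1 hq0 hq1
  have h1 : 1 - q ≠ 0 := (sub_pos.2 hq1).ne'
  have ht2 : (√q * q) ^ 2 = q ^ 3 := by rw [mul_pow, Real.sq_sqrt hq0.le]; ring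
  -- The offset m contributes q^(-3m) = (1 - q)^(-3), which cancels the surplus powers of 1 - q.
  have htm : ((√q * q) ^ (-m)) ^ 2 = ((1 - q) ^ 3)⁻¹ := by
    rw [zpow_neg, inv_pow, ← zpow_natCast, zpow_comm, zpow_natCast, ht2, hm, ← zpow_natCast,
      zpow_comm, zpow_natCast]
  rw [← (Equiv.addRight (1 + m)).tsum_eq] at h
  calc ∑' n, sinKernel q m n * sinKernel q m n
      = (fourierConst q * (1 - q) ^ 2 * q⁻¹ * (√q * q) ^ (-m) / euler (q ^ 2) q) ^ 2 *
          (√q * q * euler (q ^ 2) (q ^ 2)) ^ 2 := by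
        rw [← h, ← tsum_mul_left]
        refine tsum_congr fun n => ?_
        rw [sinKernel_eq hq0, Equiv.coe_addRight]
        ring
    _ = fourierConst q ^ 2 * (q * (1 - q) * euler (q ^ 2) (q ^ 2) ^ 2) /
          euler (q ^ 2) q ^ 2 := by
        rw [div_pow, mul_pow, mul_pow _ (euler _ _), ht2, htm]
        field_simp
    _ = 1 := by rw [fourierConst_sq hq0 hq1]; field_simp

/-! ### Convergence of the cosine transform and summation by parts. -/

variable {f : ℝ → ℂ} (hf : Summable fun n : ℤ => ‖f (q ^ n)‖ ^ 2 * q ^ n)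

include hf in
-- Square-summability bounds |f(q^n)| q^(n/2); the other half of q^n is the weight t^n with t = √q
-- in the generating function.
theorem summable_norm_mul_sin (m k : ℤ) : Summable fun n : ℤ =>
    ‖f (q ^ n) * ((q ^ (n + k) * qSinSeries q ((q ^ 2) ^ (n + k + m)) : ℝ) : ℂ)‖ := by
  have hr0 := Real.sqrt_pos.2 hq0
  have hJ := summable_qBessel_weighted hq0 hq1 hr0 (sqrt_lt_one_of_lt_one hq1) (q ^ 3) (k + m)
  set B := ∑' n : ℤ, ‖f (q ^ n)‖ ^ 2 * q ^ n
  have hbound : ∀ n : ℤ, ‖f (q ^ n)‖ * √q ^ n ≤ √B := fun n => by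
    refine Real.le_sqrt_of_sq_le ?_
    rw [mul_pow, sq (√q ^ n), sqrt_zpow_mul_self hq0]
    exact hf.le_tsum n fun j _ => by positivity
  refine (hJ.mul_left (√B * q ^ k * ‖(euler (q ^ 2) q)⁻¹‖)).of_nonneg_of_le
    (fun _ => norm_nonneg _) fun n => ?_
  rw [norm_mul, Complex.norm_real, qSinSeries, ← add_assoc, div_eq_mul_inv, norm_mul, norm_mul,
    norm_mul, show q ^ (n + k) = √q ^ n * √q ^ n * q ^ k by
      rw [sqrt_zpow_mul_self hq0, zpow_add₀ hq0.ne'],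
    Real.norm_of_nonneg (show 0 ≤ √q ^ n * √q ^ n * q ^ k by positivity),
    Real.norm_of_nonneg (show 0 ≤ √q ^ n by positivity)]
  calc _ = (‖f (q ^ n)‖ * √q ^ n) * (q ^ k * ‖(euler (q ^ 2) q)⁻¹‖ *
        (√q ^ n * ‖qBessel (q ^ 2) (q ^ 3) ((q ^ 2) ^ (n + k + m))‖)) := by ring
    _ ≤ √B * (q ^ k * ‖(euler (q ^ 2) q)⁻¹‖ *
        (√q ^ n * ‖qBessel (q ^ 2) (q ^ 3) ((q ^ 2) ^ (n + k + m))‖)) := by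
        gcongr
        exact hbound n
    _ = _ := by ring

include hm in
theorem zpow_mul_cos (k n : ℤ) :
    q ^ k * (cos q (q ^ k * q ^ n) * q ^ n) =
      q ^ (n + k) * qSinSeries q ((q ^ 2) ^ (n + k + m)) -
        q ^ (n + (k + 1)) * qSinSeries q ((q ^ 2) ^ (n + (k + 1) + m)) := by
  have hp : q ^ 2 ≠ 0 := by positivity
  have e1 : ((1 - q) * (q ^ k * q ^ n)) ^ 2 = (q ^ 2) ^ (n + k + m) := by
    rw [hm, ← zpow_add₀ hq0.ne', ← zpow_add₀ hq0.ne', ← zpow_natCast, ← zpow_natCast, ← zpow_mul,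
      ← zpow_mul]
    congr 1; ring
  have e2 : q ^ 2 * (q ^ 2) ^ (n + k + m) = (q ^ 2) ^ (n + (k + 1) + m) := by
    rw [show n + (k + 1) + m = n + k + m + 1 by ring, zpow_add_one₀ hp, mul_comm]
  rw [cos_eq_qSinSeries hq0 hq1, e1, e2, ← add_assoc n k 1, zpow_add_one₀ hq0.ne',
    zpow_add₀ hq0.ne' n k]
  ring

include hm hf in
theorem jacksonIntegrable_mul_cos (k : ℤ) :
    JacksonIntegrable q fun t => f t * (cos q (q ^ k * t) : ℂ) := by
  have h0 := (summable_norm_mul_sin hq0 hq1 hf m k).of_norm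
  have h1 := (summable_norm_mul_sin hq0 hq1 hf m (k + 1)).of_norm
  refine (((h0.sub h1).norm).mul_left ‖((q ^ k : ℝ) : ℂ)‖⁻¹).congr fun n => ?_
  have hk : ((q ^ k : ℝ) : ℂ) ≠ 0 := by
    rw [Complex.ofReal_ne_zero]; positivity
  rw [← mul_sub, ← Complex.ofReal_sub, ← zpow_mul_cos hq0 hq1 hm, ← norm_inv, ← norm_mul]
  congr 1
  rw [Complex.ofReal_mul, Complex.ofReal_mul]
  field_simp

include hm hf in
/-- Summation by parts expresses `x * ℱ_q f (x)` as a `q`-sine transform of `D_q f`. -/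
theorem mul_fourierCos_eq (k : ℤ) :
    ((√q ^ k * q ^ k : ℝ) : ℂ) * fourierCos q f (q ^ k) =
      -(√q : ℂ) * ∑' n : ℤ, (qDeriv q f (q ^ n) * ((√q ^ n : ℝ) : ℂ)) *
        (sinKernel q m (n + k) : ℂ) := by
  have h0 := (summable_norm_mul_sin hq0 hq1 hf m k).of_norm
  have h1 := (summable_norm_mul_sin hq0 hq1 hf m (k + 1)).of_norm
  set τ : ℤ → ℝ := fun j => q ^ j * qSinSeries q ((q ^ 2) ^ (j + m)) with hτ
  -- No boundary terms arise: both series converge and one is a reindexing of the other.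
  have hparts : ∑' n : ℤ, f (q ^ n) * ((τ (n + k) : ℝ) : ℂ) =
      ∑' n : ℤ, f (q ^ (n + 1)) * ((τ (n + (k + 1)) : ℝ) : ℂ) := by
    rw [← (Equiv.addRight (1 : ℤ)).tsum_eq]
    refine tsum_congr fun n => ?_
    rw [Equiv.coe_addRight, add_assoc, add_comm 1 k]
  have hs1 : Summable fun n : ℤ => f (q ^ (n + 1)) * ((τ (n + (k + 1)) : ℝ) : ℂ) := by
    refine (h0.comp_injective (add_left_injective (1 : ℤ))).congr fun n => ?_
    rw [Function.comp_apply, add_assoc, add_comm 1 k]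
  have hint : ((q ^ k : ℝ) : ℂ) * ∑' n : ℤ, f (q ^ n) * (cos q (q ^ k * q ^ n) : ℂ) *
      ((q ^ n : ℝ) : ℂ) =
      ∑' n : ℤ, (f (q ^ (n + 1)) - f (q ^ n)) * ((τ (n + (k + 1)) : ℝ) : ℂ) := by
    calc _ = ∑' n : ℤ, (f (q ^ n) * ((τ (n + k) : ℝ) : ℂ) -
          f (q ^ n) * ((τ (n + (k + 1)) : ℝ) : ℂ)) := by
          rw [← tsum_mul_left]
          refine tsum_congr fun n => ?_
          rw [← mul_sub, ← Complex.ofReal_sub, hτ]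
          simp only
          rw [← zpow_mul_cos hq0 hq1 hm, Complex.ofReal_mul, Complex.ofReal_mul]
          ring
      _ = _ := by
          rw [h0.tsum_sub h1, hparts, ← hs1.tsum_sub h1]
          exact tsum_congr fun n => (sub_mul _ _ _).symm
  have hr0 := Real.sqrt_pos.2 hq0
  rw [fourierCos, jacksonIntegral, Complex.ofReal_mul]
  calc _ = (√q ^ k : ℝ) * fourierConst q * (1 - q : ℝ) * (((q ^ k : ℝ) : ℂ) *
        ∑' n : ℤ, f (q ^ n) * (cos q (q ^ k * q ^ n) : ℂ) * ((q ^ n : ℝ) : ℂ)) := by ring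
    _ = _ := by
      rw [hint, ← tsum_mul_left, ← tsum_mul_left]
      refine tsum_congr fun n => ?_
      have hqn : q ^ n ≠ 0 := by positivity
      have hd : f (q ^ (n + 1)) - f (q ^ n) =
          -(qDeriv q f (q ^ n) * (((1 - q) * q ^ n : ℝ) : ℂ)) := by
        have h2 : (((1 - q) * q ^ n : ℝ) : ℂ) ≠ 0 := by
          rw [Complex.ofReal_ne_zero]
          exact mul_ne_zero (sub_pos.2 hq1).ne' hqn
        rw [qDeriv, if_neg hqn, div_mul_cancel₀ _ h2, zpow_add_one₀ hq0.ne', mul_comm q]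
        ring
      -- The half-weights √q^n and √q^k come from the measures. The sine is evaluated at n + k + 1
      -- after the reindexing, and normalizing the kernel leaves the factor √q.
      have hK : √q ^ k * fourierConst q * (1 - q) * (((1 - q) * q ^ n) * τ (n + (k + 1))) =
          √q * (√q ^ n * sinKernel q m (n + k)) := by
        have e : (√q * q) ^ (n + k + 1) = √q ^ n * √q ^ k * √q * q ^ (n + (k + 1)) := by
          rw [mul_zpow, ← add_assoc, zpow_add_one₀ hr0.ne', zpow_add₀ hr0.ne']
        rw [sinKernel, hτ, e]
        simp only
        rw [← add_assoc, ← sqrt_zpow_mul_self hq0 n]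
        generalize qSinSeries q ((q ^ 2) ^ (n + k + 1 + m)) = S
        generalize q ^ (n + k + 1) = Q
        have hqi : √q * √q * q⁻¹ = 1 := by
          rw [Real.mul_self_sqrt hq0.le, mul_inv_cancel₀ hq0.ne']
        linear_combination -(√q ^ k * fourierConst q * (1 - q) ^ 2 * √q ^ n * √q ^ n * S * Q) * hqi
      have hK' := congrArg (fun z : ℝ => (z : ℂ)) hK
      simp only [Complex.ofReal_mul] at hK'
      rw [hd]
      simp only [Complex.ofReal_mul]
      linear_combination -(qDeriv q f (q ^ n)) * hK'

end

/-! ### The isometry for D_q f, the Heisenberg-type inequality, and the conclusion. -/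

theorem tsum_mul_le_sqrt_mul_sqrt {ι : Type*} (a b : ι → ENNReal) :
    ∑' n, a n * b n ≤ (∑' n, a n ^ 2) ^ (1 / 2 : ℝ) * (∑' n, b n ^ 2) ^ (1 / 2 : ℝ) := by
  rw [ENNReal.tsum_eq_iSup_sum]
  refine iSup_le fun s => ?_
  refine (ENNReal.inner_le_Lp_mul_Lq s a b Real.HolderConjugate.two_two).trans ?_
  simp only [ENNReal.rpow_two]
  gcongr <;> exact ENNReal.sum_le_tsum s

section
variable {q : ℝ} (hq0 : 0 < q) (hq1 : q < 1)
include hq0 hq1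

theorem summable_of_memLq {f : ℝ → ℂ} (hf : MemLq q 2 f) :
    Summable fun n : ℤ => ‖f (q ^ n)‖ ^ 2 * q ^ n := by
  have h1 : ENNReal.ofReal (1 - q) ≠ 0 := by simpa using hq1
  have h2 := (ENNReal.lt_top_of_mul_ne_top_right (ne_of_lt hf) h1).ne
  refine (ENNReal.summable_toReal h2).congr fun n => ?_
  rw [ENNReal.toReal_mul, ENNReal.toReal_pow, toReal_enorm, ENNReal.toReal_ofReal (by positivity)]

theorem jacksonLIntegral_mul_fourierCos {m : ℤ} (hm : 1 - q = q ^ m) {f : ℝ → ℂ}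
    (hf : MemLq q 2 f) (hDf : MemLq q 2 (qDeriv q f)) :
    (jacksonLIntegral q fun x => ENNReal.ofReal (x ^ 2) * ‖fourierCos q f x‖ₑ ^ 2) =
      ENNReal.ofReal q * jacksonLIntegral q fun x => ‖qDeriv q f x‖ₑ ^ 2 := by
  have hs := summable_of_memLq hq0 hq1 hf
  have hnorm : ∀ n : ℤ, ‖qDeriv q f (q ^ n) * ((√q ^ n : ℝ) : ℂ)‖ ^ 2 =
      ‖qDeriv q f (q ^ n)‖ ^ 2 * q ^ n := fun n => by
    rw [norm_mul, mul_pow, Complex.norm_real, Real.norm_of_nonneg (by positivity), sq (√q ^ n),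
      sqrt_zpow_mul_self hq0]
  have hv : Summable fun n : ℤ => ‖qDeriv q f (q ^ n) * ((√q ^ n : ℝ) : ℂ)‖ ^ 2 := by
    simpa only [hnorm] using summable_of_memLq hq0 hq1 hDf
  obtain ⟨hT, hTv⟩ := hankel_isometry (summable_sinKernel hq0 hq1 m)
    (tsum_sinKernel_sq hq0 hq1 hm) (fun l hl => sinKernel_orthogonal hq0 hq1 m hl) hv
  set T : ℤ → ℂ := fun k => ∑' n : ℤ, (qDeriv q f (q ^ n) * ((√q ^ n : ℝ) : ℂ)) *
        (sinKernel q m (n + k) : ℂ)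
  have hterm : ∀ k : ℤ, ENNReal.ofReal ((q ^ k) ^ 2) * ‖fourierCos q f (q ^ k)‖ₑ ^ 2 *
      ENNReal.ofReal (q ^ k) = ENNReal.ofReal q * ENNReal.ofReal (‖T k‖ ^ 2) := fun k => by
    have h := congrArg (fun z => ‖z‖ ^ 2) (mul_fourierCos_eq hq0 hq1 hm hs k)
    simp only [norm_mul, mul_pow, norm_neg, Complex.norm_real, Real.norm_eq_abs, sq_abs,
      Real.sq_sqrt hq0.le] at h
    rw [sq (√q ^ k), sqrt_zpow_mul_self hq0] at h
    rw [← ofReal_norm, ← ENNReal.ofReal_pow (norm_nonneg _), ← ENNReal.ofReal_mul (by positivity),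
      ← ENNReal.ofReal_mul (by positivity), ← ENNReal.ofReal_mul hq0.le, ← h]
    congr 1; ring
  have hD : ∀ n : ℤ, ‖qDeriv q f (q ^ n)‖ₑ ^ 2 * ENNReal.ofReal (q ^ n) =
      ENNReal.ofReal (‖qDeriv q f (q ^ n) * ((√q ^ n : ℝ) : ℂ)‖ ^ 2) := fun n => by
    rw [hnorm, ENNReal.ofReal_mul (by positivity), ENNReal.ofReal_pow (norm_nonneg _), ofReal_norm]
  rw [jacksonLIntegral, jacksonLIntegral, mul_left_comm]
  simp only [hterm, hD]
  rw [ENNReal.tsum_mul_left, ← ENNReal.ofReal_tsum_of_nonneg (fun _ => by positivity) hT,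
    ← ENNReal.ofReal_tsum_of_nonneg (fun _ => by positivity) hv, hTv]

/-- The `q`-analogue of `‖f‖² ≤ 2 ‖t f‖ ‖f'‖`. -/
theorem jacksonLIntegral_le_mul_qDeriv {f : ℝ → ℂ} (hf : MemLq q 2 f) :
    (jacksonLIntegral q fun t => ‖f t‖ₑ ^ 2) ≤
      ENNReal.ofReal (q + (√q)⁻¹) *
        ((jacksonLIntegral q fun t => ENNReal.ofReal (t ^ 2) * ‖f t‖ₑ ^ 2) ^ (1 / 2 : ℝ) *
          (jacksonLIntegral q fun t => ‖qDeriv q f t‖ₑ ^ 2) ^ (1 / 2 : ℝ)) := by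
  have hr0 := Real.sqrt_pos.2 hq0
  have h1q : 0 < 1 - q := sub_pos.2 hq1
  have hδ0 : ENNReal.ofReal (1 - q) ≠ 0 := by simpa using hq1
  have hδt : ENNReal.ofReal (1 - q) ≠ ⊤ := ENNReal.ofReal_ne_top
  set A := ∑' n : ℤ, ‖f (q ^ n)‖ₑ ^ 2 * ENNReal.ofReal (q ^ n)
  set X := ∑' n : ℤ, ENNReal.ofReal ((q ^ n) ^ 2) * ‖f (q ^ n)‖ₑ ^ 2 * ENNReal.ofReal (q ^ n)
  set Y := ∑' n : ℤ, ‖qDeriv q f (q ^ n)‖ₑ ^ 2 * ENNReal.ofReal (q ^ n)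
  have hAt : A ≠ ⊤ := (ENNReal.lt_top_of_mul_ne_top_right (ne_of_lt hf) hδ0).ne
  let d : ℤ → ENNReal := fun n => ENNReal.ofReal (√q ^ n * ‖qDeriv q f (q ^ n)‖)
  let u : ℤ → ENNReal := fun n => ENNReal.ofReal (√q ^ n * (q ^ n * ‖f (q ^ n)‖))
  -- With a, b the moduli at q^n, q^(n+1), this is b² - a² = (b - a)(b + a) and b - a ≤ |D_q f(q^n)|
  -- (1 - q) q^n. The a-part carries q; the b-part carries q^(-1/2), because `u` is taken at n + 1.
  have hterm : ∀ n : ℤ, ‖f (q ^ (n + 1))‖ₑ ^ 2 * ENNReal.ofReal (q ^ (n + 1)) ≤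
      ENNReal.ofReal q * (‖f (q ^ n)‖ₑ ^ 2 * ENNReal.ofReal (q ^ n)) + ENNReal.ofReal (1 - q) *
        (ENNReal.ofReal q * (d n * u n) + ENNReal.ofReal (√q)⁻¹ * (d n * u (n + 1))) := fun n => by
    simp only [d, u]
    have hqn : 0 < q ^ n := by positivity
    have hd : ‖f (q ^ n) - f (q ^ (n + 1))‖ = ‖qDeriv q f (q ^ n)‖ * ((1 - q) * q ^ n) := by
      rw [qDeriv, if_neg hqn.ne', norm_div, Complex.norm_real,
        Real.norm_of_nonneg (by positivity), div_mul_cancel₀ _ (by positivity), zpow_add_one₀ hq0.ne',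
        mul_comm q]
    have htri : ‖f (q ^ (n + 1))‖ - ‖f (q ^ n)‖ ≤ ‖qDeriv q f (q ^ n)‖ * ((1 - q) * q ^ n) := by
      rw [← hd, ← norm_sub_rev]
      exact norm_sub_norm_le _ _
    rw [← ofReal_norm, ← ofReal_norm, ← ENNReal.ofReal_pow (norm_nonneg _),
      ← ENNReal.ofReal_pow (norm_nonneg _)]
    repeat rw [← ENNReal.ofReal_mul (by positivity)]
    rw [← ENNReal.ofReal_add (by positivity) (by positivity),
      ← ENNReal.ofReal_mul h1q.le, ← ENNReal.ofReal_add (by positivity) (by positivity)]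
    refine ENNReal.ofReal_le_ofReal ?_
    have hrr := sqrt_zpow_mul_self hq0 n
    have ha := norm_nonneg (f (q ^ n))
    have hb := norm_nonneg (f (q ^ (n + 1)))
    rw [zpow_add_one₀ hr0.ne']
    have hq' : q ^ (n + 1) = q ^ n * q := zpow_add_one₀ hq0.ne' n
    generalize ‖f (q ^ n)‖ = a at *
    generalize ‖f (q ^ (n + 1))‖ = b at *
    generalize ‖qDeriv q f (q ^ n)‖ = D at *
    rw [hq']
    have h2 := mul_le_mul_of_nonneg_left htri
      (show 0 ≤ q * q ^ n * (a + b) by positivity)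
    have hrinv : (√q)⁻¹ * √q = 1 := inv_mul_cancel₀ hr0.ne'
    calc b ^ 2 * (q ^ n * q) ≤ q * (a ^ 2 * q ^ n) + (1 - q) * (q * (q ^ n * D * (q ^ n * a)) +
          q ^ n * D * (q ^ n * q * b)) := by linarith
      _ = _ := by
        linear_combination (-(1 - q) * q * D * q ^ n * a) * hrr -
          ((1 - q) * D * q ^ n * q * b) * (hrr + √q ^ n * √q ^ n * hrinv)
  have hle : A ≤ ENNReal.ofReal q * A + ENNReal.ofReal (1 - q) *
      (ENNReal.ofReal (q + (√q)⁻¹) * (X ^ (1 / 2 : ℝ) * Y ^ (1 / 2 : ℝ))) := by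
    have hdY : ∑' n, d n ^ 2 = Y := tsum_congr fun n => by
      rw [← ofReal_norm, ← ENNReal.ofReal_pow (by positivity), ← ENNReal.ofReal_pow (by positivity),
        ← ENNReal.ofReal_mul (by positivity), ← sqrt_zpow_mul_self hq0 n]
      congr 1; ring
    have huX : ∑' n, u n ^ 2 = X := tsum_congr fun n => by
      rw [← ofReal_norm, ← ENNReal.ofReal_pow (by positivity), ← ENNReal.ofReal_pow (by positivity),
        ← ENNReal.ofReal_mul (by positivity), ← ENNReal.ofReal_mul (by positivity)]
      congr 1
      linear_combination (q ^ n * ‖f (q ^ n)‖) ^ 2 * sqrt_zpow_mul_self hq0 n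
    have hR1 := tsum_mul_le_sqrt_mul_sqrt d u
    have hR2 := tsum_mul_le_sqrt_mul_sqrt d fun n => u (n + 1)
    have hushift : ∑' n, u (n + 1) ^ 2 = ∑' n, u n ^ 2 :=
      (Equiv.addRight (1 : ℤ)).tsum_eq fun n => u n ^ 2
    rw [hushift, hdY, huX, mul_comm] at hR2
    rw [hdY, huX, mul_comm] at hR1
    calc A = ∑' n : ℤ, ‖f (q ^ (n + 1))‖ₑ ^ 2 * ENNReal.ofReal (q ^ (n + 1)) :=
          ((Equiv.addRight (1 : ℤ)).tsum_eq
            fun n : ℤ => ‖f (q ^ n)‖ₑ ^ 2 * ENNReal.ofReal (q ^ n)).symm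
      _ ≤ _ := ENNReal.tsum_le_tsum hterm
      _ = ENNReal.ofReal q * A + ENNReal.ofReal (1 - q) * (ENNReal.ofReal q * ∑' n, d n * u n +
            ENNReal.ofReal (√q)⁻¹ * ∑' n, d n * u (n + 1)) := by
          rw [ENNReal.tsum_add, ENNReal.tsum_mul_left, ENNReal.tsum_mul_left, ENNReal.tsum_add,
            ENNReal.tsum_mul_left, ENNReal.tsum_mul_left]
      _ ≤ _ := by
          rw [ENNReal.ofReal_add hq0.le (by positivity), add_mul]
          gcongr
  have hsplit : A = ENNReal.ofReal q * A + ENNReal.ofReal (1 - q) * A := by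
    rw [← add_mul, ← ENNReal.ofReal_add hq0.le h1q.le, add_sub_cancel, ENNReal.ofReal_one, one_mul]
  -- Subtracting q A needs A finite, which is the hypothesis f ∈ L².
  have hcancel : A ≤ ENNReal.ofReal (q + (√q)⁻¹) * (X ^ (1 / 2 : ℝ) * Y ^ (1 / 2 : ℝ)) := by
    rw [← ENNReal.mul_le_mul_iff_right hδ0 hδt,
      ← ENNReal.add_le_add_iff_left (ENNReal.mul_ne_top (ENNReal.ofReal_ne_top (r := q)) hAt),
      ← hsplit]
    exact hle
  have hδ : ENNReal.ofReal (1 - q) ^ (1 / 2 : ℝ) * ENNReal.ofReal (1 - q) ^ (1 / 2 : ℝ) =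
      ENNReal.ofReal (1 - q) := by
    rw [← ENNReal.rpow_add _ _ hδ0 hδt]; norm_num
  calc (jacksonLIntegral q fun t => ‖f t‖ₑ ^ 2) = ENNReal.ofReal (1 - q) * A := rfl
    _ ≤ ENNReal.ofReal (1 - q) *
        (ENNReal.ofReal (q + (√q)⁻¹) * (X ^ (1 / 2 : ℝ) * Y ^ (1 / 2 : ℝ))) := by gcongr
    _ = _ := by
      rw [jacksonLIntegral, jacksonLIntegral, ENNReal.mul_rpow_of_nonneg _ _ (by norm_num),
        ENNReal.mul_rpow_of_nonneg _ _ (by norm_num)]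
      nth_rewrite 1 [← hδ]
      ring

end

theorem zpow_of_log_div_log {q : ℝ} (hq0 : 0 < q) (hq1 : q < 1) {m : ℤ}
    (hm : Real.log (1 - q) / Real.log q = m) : 1 - q = q ^ m := by
  rw [div_eq_iff (Real.log_neg hq0 hq1).ne, ← Real.log_zpow] at hm
  exact Real.log_injOn_pos (sub_pos.2 hq1) (zpow_pos hq0 m) hm

end QCalc

end

theorem mainTheorem1 (q : ℝ) (hq0 : 0 < q) (hq1 : q < 1)
    (hq : ∃ m : ℤ, Real.log (1 - q) / Real.log q = (m : ℝ))
    (f : ℝ → ℂ) (hf : QCalc.MemLq q 2 f) (hDf : QCalc.MemLq q 2 (QCalc.qDeriv q f)) :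
    (∀ x ∈ QCalc.lattice q,
      QCalc.JacksonIntegrable q fun t => f t * (QCalc.cos q (x * t) : ℂ)) ∧
    (QCalc.jacksonLIntegral q fun t => ENNReal.ofReal (t ^ 2) * ‖f t‖ₑ ^ 2) ^ (1 / 2 : ℝ) *
      (QCalc.jacksonLIntegral q fun x =>
        ENNReal.ofReal (x ^ 2) * ‖QCalc.fourierCos q f x‖ₑ ^ 2) ^ (1 / 2 : ℝ) ≥
    ENNReal.ofReal (q / (q ^ (3 / 2 : ℝ) + 1)) * QCalc.lpNorm q 2 f ^ 2 := by
  obtain ⟨m, hm⟩ := hq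
  have hm := QCalc.zpow_of_log_div_log hq0 hq1 hm
  have hr0 := Real.sqrt_pos.2 hq0
  refine ⟨?_, ?_⟩
  · rintro _ ⟨k, rfl⟩
    exact QCalc.jacksonIntegrable_mul_cos hq0 hq1 hm (QCalc.summable_of_memLq hq0 hq1 hf) k
  · have hnorm : QCalc.lpNorm q 2 f ^ 2 = QCalc.jacksonLIntegral q fun t => ‖f t‖ₑ ^ 2 := by
      rw [QCalc.lpNorm, ← ENNReal.rpow_natCast, ← ENNReal.rpow_mul]
      simp
    have h32 : q ^ (3 / 2 : ℝ) = √q * q := by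
      rw [show (3 / 2 : ℝ) = 1 / 2 + 1 by norm_num, Real.rpow_add hq0, Real.rpow_one,
        ← Real.sqrt_eq_rpow]
    have hconst : q / (q ^ (3 / 2 : ℝ) + 1) * (q + (√q)⁻¹) = √q := by
      rw [h32]
      have hq' : √q ^ 2 = q := Real.sq_sqrt hq0.le
      field_simp
      rw [hq']
    have hsqrt : ENNReal.ofReal q ^ (1 / 2 : ℝ) = ENNReal.ofReal √q := by
      rw [ENNReal.ofReal_rpow_of_pos hq0, Real.sqrt_eq_rpow]
    rw [ge_iff_le, hnorm, QCalc.jacksonLIntegral_mul_fourierCos hq0 hq1 hm hf hDf,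
      ENNReal.mul_rpow_of_nonneg _ _ (by norm_num), hsqrt]
    refine (mul_le_mul_right (QCalc.jacksonLIntegral_le_mul_qDeriv hq0 hq1 hf) _).trans_eq ?_
    rw [← mul_assoc, ← ENNReal.ofReal_mul (by positivity), hconst, mul_left_comm]
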